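/- Let $K,K'$ be division rings such that $|K|\geq 4$, or $|K|=3$ and $\operatorname{char}K'=3$. Let $V$ be a left $K$-vector space and $V'$ a left $K'$-vector space, of arbitrary dimension, and let $\mathbb P=\mathbb P(V)$, $\mathbb P'=\mathbb P(V')$ be the projective spaces of their one-dimensional subspaces; the subspaces of $\mathbb P(V)$ are the sets $\mathbb P(W)$ with $W\subseteq V$ a vector subspace, and a hyperplane is a maximal proper subspace. Let $X\subseteq\mathbb P$ be an affino-projective subset, i.e. $X\cup H=\mathbb P$ for some hyperplane $H$ of $\mathbb P$. Regard $X$ as a subgeometry of $\mathbb P$: its subspaces are the sets $S\cap X$ with $S$ a subspace of $\mathbb P$. Let $\varphi\colon X\to\mathbb P'$ be a morphism, i.e. a map such that $\varphi^{-1}(S')$ is a subspace of $X$ for every subspace $S'$ of $\mathbb P'$, and assume that the image of $\varphi$ is not contained in a line of $\mathbb P'$ (nor reduced to a point), that is, not contained in $\mathbb P(W')$ for any vector subspace $W'\subseteq V'$ with $\dim W'\leq 2$. Then $\varphi$ is the restriction of a unique partial projective morphism $\phi\colon\mathbb P\dashrightarrow\mathbb P'$. Here a partial projective morphism is a partial map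 of the form $\langle v\rangle\mapsto\langle\Phi(v)\rangle$, with domain exactly $\mathbb P(V)\setminus\mathbb P(\ker\Phi)$, where $\Phi\colon V\to V'$ is additive and satisfies $\Phi(\lambda v)=\sigma(\lambda)\Phi(v)$ for some (unital, not necessarily surjective) ring morphism $\sigma\colon K\to K'$. That $\varphi$ is the restriction of $\phi$ means that $X$ is contained in the domain of $\phi$ and $\phi(x)=\varphi(x)$ for all $x\in X$. -/

import Mathlib

open scoped LinearAlgebra.Projectivization

universe u v

/-! ### Geometries -/

/-- The closure of `A` relative to a family `F` of subsets: the intersection of the members of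
`F` that contain `A`. -/
def flatClosure {X : Type u} (F : Set (Set X)) (A : Set X) : Set X :=
  ⋂₀ {T | T ∈ F ∧ A ⊆ T}

theorem subset_flatClosure {X : Type u} (F : Set (Set X)) (A : Set X) : A ⊆ flatClosure F A :=
  fun _ hx _ hT => hT.2 hx

theorem flatClosure_subset {X : Type u} {F : Set (Set X)} {A T : Set X} (hT : T ∈ F)
    (h : A ⊆ T) : flatClosure F A ⊆ T :=
  fun _ hx => hx T ⟨hT, h⟩

theorem flatClosure_mono {X : Type u} (F : Set (Set X)) {A B : Set X} (h : A ⊆ B) :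
    flatClosure F A ⊆ flatClosure F B :=
  fun _ hx T hT => hx T ⟨hT.1, h.trans hT.2⟩

/-- A geometry on a set `X` of points: a family of subsets, called subspaces or flats, which
contains `∅`, `X` and the points, is closed under intersections, and satisfies the exchange axiom
and the finitary axiom. -/
structure Geometry (X : Type u) where
  flats : Set (Set X)
  empty_mem : ∅ ∈ flats
  univ_mem : Set.univ ∈ flats
  singleton_mem : ∀ x : X, {x} ∈ flats
  sInter_mem : ∀ F ⊆ flats, ⋂₀ F ∈ flats
  exchange : ∀ S ∈ flats, ∀ x ∉ S,
    ¬ ∃ S' ∈ flats, S ⊂ S' ∧ S' ⊂ flatClosure flats (S ∪ {x})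
  finitary : ∀ (A : Set X), ∀ x ∈ flatClosure flats A,
    ∃ B : Set X, B ⊆ A ∧ B.Finite ∧ x ∈ flatClosure flats B

namespace Geometry

theorem flatClosure_mem {X : Type u} (G : Geometry X) (A : Set X) :
    flatClosure G.flats A ∈ G.flats :=
  G.sInter_mem _ fun _ hT => hT.1

/-- The flats of the subgeometry on `A`: the traces on `A` of the flats of `G`. -/
def traceFlats {X : Type u} (G : Geometry X) (A : Set X) : Set (Set A) :=
  {T | ∃ S ∈ G.flats, T = Subtype.val ⁻¹' S}

theorem flatClosure_traceFlats {X : Type u} (G : Geometry X) (A : Set X) (B : Set A) :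
    flatClosure (G.traceFlats A) B =
      Subtype.val ⁻¹' (flatClosure G.flats (Subtype.val '' B)) := by
  apply Set.Subset.antisymm
  · refine flatClosure_subset ⟨_, G.flatClosure_mem _, rfl⟩ ?_
    exact Set.image_subset_iff.1 (subset_flatClosure _ _)
  · rintro x hx _ ⟨⟨S, hS, rfl⟩, hBS⟩
    exact hx S ⟨hS, Set.image_subset_iff.2 hBS⟩

/-- The subgeometry of `G` on a subset `A` of its points. -/
def subgeometry {X : Type u} (G : Geometry X) (A : Set X) : Geometry A where
  flats := G.traceFlats A
  empty_mem := ⟨∅, G.empty_mem, rfl⟩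
  univ_mem := ⟨Set.univ, G.univ_mem, rfl⟩
  singleton_mem x := ⟨{x.1}, G.singleton_mem x.1, by ext y; simp [Subtype.ext_iff]⟩
  sInter_mem F hF := by
    refine ⟨⋂₀ {S | S ∈ G.flats ∧ Subtype.val ⁻¹' S ∈ F}, G.sInter_mem _ fun _ h => h.1, ?_⟩
    ext x
    constructor
    · rintro hx S ⟨-, hS⟩
      exact hx _ hS
    · intro hx T hT
      obtain ⟨S, hS, rfl⟩ := hF hT
      exact hx S ⟨hS, hT⟩
  exchange := by
    rintro S hS x hxS ⟨S', hS', hlt, hlt'⟩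
    have key : ∀ T ∈ G.traceFlats A,
        Subtype.val ⁻¹' (flatClosure G.flats (Subtype.val '' T)) = T := by
      intro T hT
      rw [← G.flatClosure_traceFlats A T]
      exact (flatClosure_subset hT subset_rfl).antisymm (subset_flatClosure _ _)
    refine G.exchange _ (G.flatClosure_mem (Subtype.val '' S)) x.1 ?_
      ⟨_, G.flatClosure_mem (Subtype.val '' S'), ?_, ?_⟩
    · intro h
      apply hxS
      rw [← key S hS]
      exact h
    · refine (flatClosure_mono _ (Set.image_mono hlt.subset)).ssubset_of_ne fun h => hlt.ne ?_
      rw [← key S hS, ← key S' hS', h]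
    · have h1 : flatClosure G.flats (Subtype.val '' (S ∪ {x})) ⊆
          flatClosure G.flats (flatClosure G.flats (Subtype.val '' S) ∪ {x.1}) := by
        apply flatClosure_mono
        rw [Set.image_union, Set.image_singleton]
        exact Set.union_subset_union_left _ (subset_flatClosure _ _)
      have h2 : flatClosure G.flats (Subtype.val '' S') ⊆
          flatClosure G.flats (Subtype.val '' (S ∪ {x})) := by
        refine flatClosure_subset (G.flatClosure_mem _) ?_
        rw [Set.image_subset_iff, ← G.flatClosure_traceFlats]
        exact hlt'.subset
      refine (h2.trans h1).ssubset_of_ne fun h => hlt'.ne ?_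
      refine hlt'.subset.antisymm ?_
      rw [G.flatClosure_traceFlats]
      conv_rhs => rw [← key S' hS', h]
      exact fun y hy => h1 hy
  finitary := by
    intro B x hx
    rw [G.flatClosure_traceFlats] at hx
    obtain ⟨C, hCB, hC, hxC⟩ := G.finitary _ _ hx
    refine ⟨Subtype.val ⁻¹' C, ?_, hC.preimage Subtype.val_injective.injOn, ?_⟩
    · intro y hy
      obtain ⟨z, hz, hzy⟩ := hCB hy
      rwa [← Subtype.val_injective hzy]
    · rw [G.flatClosure_traceFlats]
      have : Subtype.val '' (Subtype.val ⁻¹' C : Set A) = C := by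
        rw [Subtype.image_preimage_coe, Set.inter_eq_right]
        intro y hy
        obtain ⟨z, -, rfl⟩ := hCB hy
        exact z.2
      rw [this]
      exact hxC

/-- A morphism of geometries: the preimage of every flat is a flat. -/
def IsMorphism {X : Type u} {Y : Type v} (G : Geometry X) (G' : Geometry Y) (f : X → Y) : Prop :=
  ∀ S ∈ G'.flats, f ⁻¹' S ∈ G.flats

/-- A hyperplane: a maximal proper flat. -/
def IsHyperplane {X : Type u} (G : Geometry X) (H : Set X) : Prop :=
  H ∈ G.flats ∧ H ≠ Set.univ ∧ ∀ S ∈ G.flats, H ⊂ S → S = Set.univ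

/-- `A` is affino-projective: it covers the geometry together with some hyperplane. -/
def IsAffinoProjective {X : Type u} (G : Geometry X) (A : Set X) : Prop :=
  ∃ H : Set X, G.IsHyperplane H ∧ A ∪ H = Set.univ

end Geometry

/-! ### The projective space of a vector space -/

section Projective

variable (K : Type u) (V : Type v) [DivisionRing K] [AddCommGroup V] [Module K V]

theorem flatClosure_projective (A : Set (ℙ K V)) :
    flatClosure (Set.range ((↑) : Projectivization.Subspace K V → Set (ℙ K V))) A =
      Projectivization.Subspace.span A := by
  apply Set.Subset.antisymm
  · exact flatClosure_subset ⟨_, rfl⟩ (Projectivization.Subspace.subset_span A)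
  · rintro x hx _ ⟨⟨W, rfl⟩, hA⟩
    exact (Projectivization.Subspace.span_le_subspace_iff.2 hA) hx

theorem projective_sup_point (W : Projectivization.Subspace K V) (x : ℙ K V) :
    Projectivization.Subspace.span ((W : Set (ℙ K V)) ∪ {x}) =
      (W.submodule ⊔ x.submodule).projectivization := by
  apply le_antisymm
  · rw [Projectivization.Subspace.span_le_subspace_iff]
    rintro y (hy | hy)
    · induction y with
      | h w hw =>
        change _ ∈ Submodule.projectivization _
        rw [Submodule.mk_mem_projectivization_iff]
        exact Submodule.mem_sup_left ((W.mem_submodule_iff hw).2 hy)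
    · obtain rfl : y = x := hy
      change _ ∈ Submodule.projectivization _
      rw [Submodule.mem_projectivization_iff_submodule_le]
      exact le_sup_right
  · rw [← OrderIso.le_symm_apply, OrderIso.symm_symm]
    refine sup_le ?_ ?_
    · rw [OrderIso.le_iff_le]
      exact fun y hy => Projectivization.Subspace.subset_span _ (Or.inl hy)
    · have := Projectivization.Subspace.subset_span ((W : Set (ℙ K V)) ∪ {x})
        (show x ∈ (W : Set (ℙ K V)) ∪ {x} from Or.inr rfl)
      induction x with
      | h w hw =>
        rw [Projectivization.submodule_mk, Submodule.span_singleton_le_iff_mem,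
          Projectivization.Subspace.mem_submodule_iff _ hw]
        exact this

/-- The projective space of `V` as a geometry: its flats are the projective subspaces. -/
def projectiveGeometry : Geometry (ℙ K V) where
  flats := Set.range ((↑) : Projectivization.Subspace K V → Set (ℙ K V))
  empty_mem := ⟨⊥, Projectivization.Subspace.bot_coe⟩
  univ_mem := ⟨Projectivization.Subspace.span Set.univ,
    Set.univ_subset_iff.1 (Projectivization.Subspace.subset_span Set.univ)⟩
  singleton_mem x := by
    refine ⟨x.submodule.projectivization, ?_⟩
    ext y
    change y ∈ Submodule.projectivization _ ↔ _
    rw [Submodule.mem_projectivization_iff_submodule_le, Set.mem_singleton_iff]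
    refine ⟨fun h => ?_, fun h => h ▸ le_rfl⟩
    apply Projectivization.submodule_injective
    exact Submodule.eq_of_le_of_finrank_eq h
      (y.finrank_submodule.trans x.finrank_submodule.symm)
  sInter_mem F hF := by
    refine ⟨sInf {W | (W : Set (ℙ K V)) ∈ F}, ?_⟩
    ext x
    constructor
    · intro hx T hT
      obtain ⟨W, rfl⟩ := hF hT
      exact hx _ ⟨W, hT, rfl⟩
    · rintro hx _ ⟨W, hW, rfl⟩
      exact hx _ hW
  exchange := by
    rintro _ ⟨W, rfl⟩ x hx ⟨_, ⟨W', rfl⟩, h1, h2⟩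
    rw [flatClosure_projective, projective_sup_point] at h2
    have hcov : W.submodule ⋖ W.submodule ⊔ x.submodule := by
      induction x with
      | h w hw =>
        rw [Projectivization.submodule_mk]
        rw [sup_comm]
        exact Submodule.covBy_span_singleton_sup (mt (W.mem_submodule_iff hw).1 hx)
    refine hcov.2 (c := W'.submodule) ?_ ?_
    · exact Projectivization.Subspace.submodule.lt_iff_lt.2 h1
    · rw [← OrderIso.lt_symm_apply]
      exact h2
  finitary := by
    intro A x hx
    rw [flatClosure_projective] at hx
    simp only [flatClosure_projective]
    change Projectivization.Subspace.spanCarrier A x at hx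
    induction hx with
    | of y hy =>
      exact ⟨{y}, by simpa using hy, Set.finite_singleton y,
        Projectivization.Subspace.subset_span _ rfl⟩
    | mem_add a b ha hb hab _ _ iha ihb =>
      obtain ⟨B, hBA, hB, hxB⟩ := iha
      obtain ⟨C, hCA, hC, hxC⟩ := ihb
      refine ⟨B ∪ C, Set.union_subset hBA hCA, hB.union hC, ?_⟩
      exact Projectivization.Subspace.mem_add _ _ _ ha hb hab
        (Projectivization.Subspace.monotone_span Set.subset_union_left hxB)
        (Projectivization.Subspace.monotone_span Set.subset_union_right hxC)

end Projective

/-! ### Partial projective morphisms -/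

section PartialProjective

variable {K : Type*} {V : Type*} [DivisionRing K] [AddCommGroup V] [Module K V]
  {K' : Type*} {V' : Type*} [DivisionRing K'] [AddCommGroup V'] [Module K' V']

/-- The partial map `⟨v⟩ ↦ ⟨Φ v⟩` of projective spaces induced by a semilinear map `Φ`, defined
exactly at the points `⟨v⟩` with `Φ v ≠ 0`, that is, outside the projectivization of the kernel
of `Φ`. -/
noncomputable def partialProjectivization {σ : K →+* K'} (Φ : V →ₛₗ[σ] V') : ℙ K V →. ℙ K' V' :=
  fun x => ⟨Φ x.rep ≠ 0, fun h => Projectivization.mk K' (Φ x.rep) h⟩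

/-- The induced partial map does not depend on the chosen representatives. -/
theorem mem_partialProjectivization_mk {σ : K →+* K'} (Φ : V →ₛₗ[σ] V') (v : V) (hv : v ≠ 0)
    (y : ℙ K' V') :
    y ∈ partialProjectivization Φ (Projectivization.mk K v hv) ↔
      ∃ h : Φ v ≠ 0, y = Projectivization.mk K' (Φ v) h := by
  obtain ⟨a, ha⟩ := Projectivization.exists_smul_eq_mk_rep K v hv
  have hΦ : Φ (Projectivization.mk K v hv).rep = σ a • Φ v := by
    rw [← ha, Units.smul_def, LinearMap.map_smulₛₗ]
  have ha' : σ (a : K) ≠ 0 := (map_ne_zero σ).2 a.ne_zero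
  constructor
  · rintro ⟨h, rfl⟩
    have h' : Φ v ≠ 0 := fun h0 => h (by rw [hΦ, h0, smul_zero])
    refine ⟨h', ?_⟩
    exact (Projectivization.mk_eq_mk_iff' K' _ _ _ _).2 ⟨σ a, hΦ.symm⟩
  · rintro ⟨h, rfl⟩
    refine ⟨?_, ?_⟩
    · change Φ _ ≠ 0
      rw [hΦ]
      exact smul_ne_zero ha' h
    · exact (Projectivization.mk_eq_mk_iff' K' _ _ _ _).2 ⟨σ a, hΦ.symm⟩

/-- A partial projective morphism: a partial map induced by some semilinear map, with respect to
an arbitrary ring morphism `σ : K → K'`. -/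
def IsPartialProjectiveMorphism (φ : ℙ K V →. ℙ K' V') : Prop :=
  ∃ (σ : K →+* K') (Φ : V →ₛₗ[σ] V'), φ = partialProjectivization Φ

end PartialProjective

/-! Choose a linear form `l` whose kernel contains the hyperplane and `v₀` with `l v₀ = 1`. The
affine space `v₀ + ker l` lies in `X`, and representatives of the images give `g : ker l → V'` for
which preimages of subspaces are affine flats (`IsFlatLift`). The core is that `g x` is proportional
to `g 0 + Φ₀ x` for a semilinear `Φ₀`.

In a plane with noncollinear image (`IsPlaneLift.exists_semiaffine`), the columns `t = 0` and `t =
1` map into two lines meeting in a point `d`, which serves as point at infinity for coordinates `τ`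
and `θ`. A perspectivity between the columns matches `z` with `r + n * z`, where `n ≠ 0, 1`; its
image is a perspectivity, so `τ z` is an affine function of `θ (r + n * z)`. Eliminating `τ` makes
`θ` compatible with all affine maps of `K`, hence a ring morphism. This elimination needs a fourth
scalar. With three scalars only `n = -1` remains, and `a = θ (-1)` satisfies `a² - a + 1 = 0`, whose
only root in characteristic 3 is `-1`.

Planes glue because the direction of a semiaffine map on a line is unique (`semiaffine_unique`).
Points with the same image as `0` have no direction; their value is forced by additivity. Sending
`v₀` to `g 0` extends `Φ₀` to `V`, the remaining points of `X` are controlled by lines through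
affine points, and uniqueness holds after rescaling at `v₀`. -/

/-! ### Functional equations that force ring morphisms -/

section FunctionalEquation

theorem exists_notMem_of_four_le {K : Type*} (h : 4 ≤ Cardinal.mk K) (a b c : K) :
    ∃ x : K, x ≠ a ∧ x ≠ b ∧ x ≠ c := by
  obtain ⟨x, hx⟩ := Cardinal.exists_notMem_of_length_lt [a, b, c] (lt_of_lt_of_le (by
    simp only [List.length_cons, List.length_nil]; norm_num) h)
  simp only [List.mem_cons, List.not_mem_nil, or_false, not_or] at hx
  exact ⟨x, hx⟩

theorem exists_notMem_of_three_le {K : Type*} (h : 3 ≤ Cardinal.mk K) (a b : K) :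
    ∃ x : K, x ≠ a ∧ x ≠ b := by
  obtain ⟨x, hx⟩ := Cardinal.exists_notMem_of_length_lt [a, b] (lt_of_lt_of_le (by
    simp only [List.length_cons, List.length_nil]; norm_num) h)
  simp only [List.mem_cons, List.not_mem_nil, or_false, not_or] at hx
  exact ⟨x, hx⟩

variable {K K' : Type*} [DivisionRing K] [DivisionRing K']

/-- A normalized map that turns every affine map of `K` into an affine map of `K'` is a ring
morphism. -/
theorem exists_ringHom_of_affine_equivariant (hK : 3 ≤ Cardinal.mk K) (θ : K → K')
    (h0 : θ 0 = 0) (h1 : θ 1 = 1) (hθ : ∀ r, θ r = 1 → r = 1)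
    (h : ∀ k, k ≠ 0 → ∀ r, ∃ c β : K', ∀ z, θ (k * z + r) = c + β * θ z) :
    ∃ σ : K →+* K', ∀ z, θ z = σ z := by
  have hmul : ∀ k z, θ (k * z) = θ k * θ z := by
    intro k z
    rcases eq_or_ne k 0 with rfl | hk
    · simp [h0]
    obtain ⟨c, β, hc⟩ := h k hk 0
    simp only [add_zero] at hc
    have e0 := hc 0
    have e1 := hc 1
    simp only [mul_zero, h0, mul_one, h1, add_zero] at e0 e1
    rw [hc z, e1, ← e0, zero_add, zero_add]
  have hne : ∀ k, k ≠ 0 → θ k ≠ 0 := by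
    intro k hk hk0
    have := hmul k k⁻¹
    rw [mul_inv_cancel₀ hk, h1, hk0, zero_mul] at this
    exact one_ne_zero this
  -- By multiplicativity, evaluation at `z = -r` shows that the slope of a translation does not
  -- depend on `r ≠ 0`.
  have htr : ∀ r, r ≠ 0 → ∀ z, θ (z + r) = θ r - (θ (-1))⁻¹ * θ z := by
    intro r hr z
    obtain ⟨c, β, hc⟩ := h 1 one_ne_zero r
    simp only [one_mul] at hc
    have e0 := hc 0
    have e1 := hc (-r)
    simp only [zero_add, h0, mul_zero, add_zero, neg_add_cancel] at e0 e1
    have e2 : θ (-r) = θ (-1) * θ r := by rw [← hmul, neg_one_mul]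
    have hn := hne (-1) (neg_ne_zero.2 one_ne_zero)
    have hr' := hne r hr
    have e3 : β = -(θ (-1))⁻¹ := by
      rw [e2, ← e0, ← mul_assoc] at e1
      have e4 : (1 + β * θ (-1)) * θ r = 0 := by rw [add_mul, one_mul]; exact e1.symm
      have e5 := (mul_eq_zero.1 e4).resolve_right hr'
      rw [← mul_inv_cancel_right₀ hn β, eq_neg_of_add_eq_zero_right e5, neg_one_mul]
    rw [hc z, e3, ← e0, neg_mul, sub_eq_add_neg]
  -- Computing `θ (1 + r)` in both orders gives `(1 + (θ (-1))⁻¹) * (1 - θ r) = 0`, and `θ r ≠ 1`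
  -- when `r ≠ 1`.
  have hneg : -(θ (-1))⁻¹ = 1 := by
    obtain ⟨r, hr0, hr1⟩ := exists_notMem_of_three_le hK 0 1
    have e1 := htr r hr0 1
    have e2 := htr 1 one_ne_zero r
    rw [add_comm, e2] at e1
    have : (1 + (θ (-1))⁻¹) * (1 - θ r) = 0 := by
      rw [add_mul, one_mul, mul_sub]
      rw [h1] at e1
      rw [sub_add_sub_comm, sub_eq_zero]
      exact sub_eq_sub_iff_add_eq_add.1 e1
    have h2 : (1 : K') - θ r ≠ 0 := fun h => hr1 (hθ r (sub_eq_zero.1 h).symm)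
    exact (eq_neg_of_add_eq_zero_left ((mul_eq_zero.1 this).resolve_right h2)).symm
  have hadd : ∀ z r, θ (z + r) = θ z + θ r := by
    intro z r
    rcases eq_or_ne r 0 with rfl | hr
    · simp [h0]
    rw [htr r hr z, sub_eq_add_neg, ← neg_mul, hneg, one_mul, add_comm]
  exact ⟨{ toFun := θ, map_one' := h1, map_mul' := hmul, map_zero' := h0, map_add' := hadd },
    fun _ => rfl⟩

theorem eq_zero_or_one_or_neg_one_of_card_eq_three (hK : Cardinal.mk K = 3) :
    (1 : K) + 1 = -1 ∧ ∀ x : K, x = 0 ∨ x = 1 ∨ x = -1 := by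
  have hN : Nat.card K = 3 := by
    rw [Nat.card, hK]; simp
  have hfin : Finite K := Nat.finite_of_card_ne_zero (by omega)
  have := Fintype.ofFinite K
  have h3 : (3 : ℕ) • (1 : K) = 0 := by rw [← hN]; exact card_nsmul_eq_zero'
  have h3' : (1 : K) + 1 = -1 := by
    rw [eq_neg_iff_add_eq_zero, ← h3, nsmul_one]; norm_num
  refine ⟨h3', fun x => ?_⟩
  by_contra hx
  simp only [not_or] at hx
  have h1 : (1 : K) ≠ -1 := by
    intro h
    rw [← h] at h3'
    exact one_ne_zero (add_eq_left.1 h3')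
  classical
  have hc : ({0, 1, -1, x} : Finset K).card = 4 := by
    have := one_ne_zero (α := K)
    rw [Finset.card_insert_of_notMem, Finset.card_insert_of_notMem,
      Finset.card_insert_of_notMem, Finset.card_singleton]
    · simpa using Ne.symm hx.2.2
    · simpa using ⟨h1, Ne.symm hx.2.1⟩
    · simpa using Ne.symm hx.1
  have := Finset.card_le_univ ({0, 1, -1, x} : Finset K)
  rw [hc, ← Nat.card_eq_fintype_card, hN] at this
  omega

/-- The functional equation satisfied by the coordinates on two parallel lines. -/
theorem exists_ringHom_of_affine_relation
    (hK : 4 ≤ Cardinal.mk K ∨ (Cardinal.mk K = 3 ∧ CharP K' 3)) (τ θ : K → K')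
    (hτ0 : τ 0 = 0) (hτ1 : τ 1 = 1) (h0 : θ 0 = 0) (h1 : θ 1 = 1) (hθ : ∀ r, θ r = 1 → r = 1)
    (h : ∀ n, n ≠ 0 → n ≠ 1 → ∀ r, ∃ c β : K', ∀ z, τ z = c + β * θ (r + n * z)) :
    ∃ σ : K →+* K', ∀ z, τ z = σ z ∧ θ z = σ z := by
  have hβ : ∀ (n r : K) (c β : K'), (∀ z, τ z = c + β * θ (r + n * z)) → β ≠ 0 := by
    rintro n r c β hc rfl
    have e0 := hc 0
    have e1 := hc 1
    rw [hτ0, zero_mul] at e0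
    rw [hτ1, zero_mul, ← e0] at e1
    exact one_ne_zero e1
  rcases hK with hK | ⟨hK, hchar⟩
  · obtain ⟨σ, hσ⟩ := exists_ringHom_of_affine_equivariant
      (le_trans (by norm_num) hK) θ h0 h1 hθ (fun k hk r => by
        -- The relations for `(n, 0)` and `(k * n, r)` share `τ`; eliminating it relates `θ (k * z +
        -- r)` to `θ z`. Avoiding `k⁻¹` ensures `k * n ≠ 1`.
        obtain ⟨n, hn0, hn1, hnk⟩ := exists_notMem_of_four_le hK 0 1 k⁻¹
        obtain ⟨c, β, hc⟩ := h n hn0 hn1 0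
        obtain ⟨c', β', hc'⟩ := h (k * n) (mul_ne_zero hk hn0)
          (fun h => hnk (eq_inv_of_mul_eq_one_right h)) r
        have hb := hβ _ _ _ _ hc'
        refine ⟨β'⁻¹ * (c - c'), β'⁻¹ * β, fun z => ?_⟩
        have e := hc (n⁻¹ * z)
        rw [hc' (n⁻¹ * z), zero_add, mul_inv_cancel_left₀ hn0, mul_assoc k,
          mul_inv_cancel_left₀ hn0] at e
        rw [add_comm, mul_assoc, ← mul_add, eq_inv_mul_iff_mul_eq₀ hb,
          sub_add_eq_add_sub, ← e, add_sub_cancel_left])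
    refine ⟨σ, fun z => ⟨?_, hσ z⟩⟩
    obtain ⟨n, hn0, hn1⟩ := exists_notMem_of_three_le (le_trans (by norm_num) hK) (0 : K) 1
    obtain ⟨c, β, hc⟩ := h n hn0 hn1 0
    simp only [zero_add, hσ, map_mul] at hc
    have e0 := hc 0
    have e1 := hc 1
    simp only [hτ0, map_zero, mul_zero, add_zero, hτ1, map_one, mul_one] at e0 e1
    rw [hc z, ← e0, zero_add, ← mul_assoc, ← zero_add (β * σ n), e0, ← e1, one_mul]
  · obtain ⟨h2, hcases⟩ := eq_zero_or_one_or_neg_one_of_card_eq_three hK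
    have h3' : (1 : K') + 1 = -1 := by
      have : ((3 : ℕ) : K') = 0 := CharP.cast_eq_zero K' 3
      rw [eq_neg_iff_add_eq_zero, ← this]; norm_num
    have hn1 : (-1 : K) ≠ 1 := by
      intro h
      rw [h] at h2
      exact one_ne_zero (add_eq_left.1 h2)
    have h2' : (-1 : K) + -1 = 1 := by rw [← neg_add_rev, h2, neg_neg]
    -- The case `r = 0` yields `1 = β * θ (-1)` and `τ (-1) = β`; the case `r = 1` yields `τ (-1) =
    -- 1 - θ (-1)`.
    obtain ⟨c, β, hc⟩ := h (-1) (by simp) hn1 0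
    obtain ⟨c', β', hc'⟩ := h (-1) (by simp) hn1 1
    have a0 := hc 0
    have a1 := hc 1
    have a2 := hc (-1)
    have b0 := hc' 0
    have b1 := hc' 1
    have b2 := hc' (-1)
    simp only [hτ0, hτ1, h0, h1, mul_zero, mul_one, add_zero, zero_add, neg_mul, one_mul, neg_neg,
      add_neg_cancel, h2] at a0 a1 a2 b0 b1 b2
    rw [← a0, zero_add] at a1 a2
    rw [← b1] at b0 b2
    have hb : β' = -1 := (eq_neg_of_add_eq_zero_right b0.symm)
    rw [hb, neg_one_mul, a2] at b2
    -- Eliminating `β` leaves `a² - a + 1 = 0` for `a = θ (-1)`, which is `(a + 1)² = 0` in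
    -- characteristic 3.
    have hp : (θ (-1) + 1) * (θ (-1) + 1) = 0 := by
      have : β * θ (-1) = (1 + -θ (-1)) * θ (-1) := by rw [← b2]
      rw [← a1] at this
      have e : (1 : K') - θ (-1) + θ (-1) * θ (-1) = 0 := by
        rw [add_mul, one_mul, neg_mul] at this
        rw [this]; abel
      have e3 : -θ (-1) = θ (-1) + θ (-1) := by
        rw [← neg_one_mul, ← h3', add_mul, one_mul]
      rw [← e, sub_eq_add_neg, e3]; noncomm_ring
    have hθn : θ (-1) = -1 := eq_neg_of_add_eq_zero_left (mul_self_eq_zero.1 hp)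
    have hτn : τ (-1) = -1 := by
      rw [a2, b2, hθn, neg_neg, h3']
    have h2n : (-1 : K') + -1 = 1 := by rw [← neg_add_rev, h3', neg_neg]
    refine ⟨{ toFun := θ, map_one' := h1, map_zero' := h0, map_mul' := ?_, map_add' := ?_ },
      fun z => ⟨?_, rfl⟩⟩
    · intro x y
      rcases hcases x with rfl | rfl | rfl <;> rcases hcases y with rfl | rfl | rfl <;>
        simp [h0, h1, hθn]
    · intro x y
      rcases hcases x with rfl | rfl | rfl <;> rcases hcases y with rfl | rfl | rfl <;>
        simp [h0, h1, hθn, h2, h2', h3', h2n]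
    · change τ z = θ z
      rcases hcases z with rfl | rfl | rfl
      exacts [hτ0.trans h0.symm, hτ1.trans h1.symm, hτn.trans hθn.symm]

end FunctionalEquation

/-! ### Linear algebra of projective points and lines -/

section LinearAlgebra

variable {K' : Type*} {V' : Type*} [DivisionRing K'] [AddCommGroup V'] [Module K' V']

/-- Modulo `D` both generators equal `u ≠ 0`, so proportional ones have ratio 1. -/
theorem eq_of_mem_span_singleton_add {D : Submodule K' V'} {u w w' v : V'} (hu : u ∉ D)
    (hw : w ∈ D) (hw' : w' ∈ D) (hv : v ≠ 0) (h : v ∈ Submodule.span K' {u + w})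
    (h' : v ∈ Submodule.span K' {u + w'}) : w = w' := by
  obtain ⟨a, rfl⟩ := Submodule.mem_span_singleton.1 h
  obtain ⟨a', ha'⟩ := Submodule.mem_span_singleton.1 h'
  have ha : a ≠ 0 := by rintro rfl; simp at hv
  have e : (a' - a) • u = a • w - a' • w' := by
    rw [smul_add, smul_add] at ha'
    rw [sub_smul, sub_eq_sub_iff_add_eq_add, ha', add_comm]
  have haa : a' = a := by
    by_contra hne
    apply hu
    rw [← D.smul_mem_iff (sub_ne_zero.2 hne), e]
    exact D.sub_mem (D.smul_mem _ hw) (D.smul_mem _ hw')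
  rw [haa, sub_self, zero_smul, ← smul_sub] at e
  exact sub_eq_zero.1 ((smul_eq_zero.1 e.symm).resolve_left ha)

theorem linearIndependent_triple_iff {u v w : V'} :
    LinearIndependent K' ![u, v, w] ↔
      ∀ a b c : K', a • u + b • v + c • w = 0 → a = 0 ∧ b = 0 ∧ c = 0 := by
  rw [Fintype.linearIndependent_iff]
  constructor
  · intro h a b c habc
    have := h ![a, b, c] (by simpa [Fin.sum_univ_three] using habc)
    exact ⟨this 0, this 1, this 2⟩
  · intro h g hg i
    have := h (g 0) (g 1) (g 2) (by simpa [Fin.sum_univ_three] using hg)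
    fin_cases i
    exacts [this.1, this.2.1, this.2.2]

theorem LinearIndependent.triple_unique {u v w : V'} (h : LinearIndependent K' ![u, v, w])
    {a b c a' b' c' : K'} (e : a • u + b • v + c • w = a' • u + b' • v + c' • w) :
    a = a' ∧ b = b' ∧ c = c' := by
  have := linearIndependent_triple_iff.1 h (a - a') (b - b') (c - c') (by
    rw [← sub_eq_zero] at e
    rw [← e]
    simp only [sub_smul]
    abel)
  simpa only [sub_eq_zero] using this

theorem LinearIndependent.not_forall_mem_span_pair {u v w : V'}
    (h : LinearIndependent K' ![u, v, w]) (x y : V') (hu : u ∈ Submodule.span K' {x, y})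
    (hv : v ∈ Submodule.span K' {x, y}) (hw : w ∈ Submodule.span K' {x, y}) : False := by
  have h1 : Submodule.span K' (Set.range ![u, v, w]) ≤ Submodule.span K' {x, y} := by
    rw [Submodule.span_le]
    rintro _ ⟨i, rfl⟩
    fin_cases i
    exacts [hu, hv, hw]
  have hfin : Module.Finite K' (Submodule.span K' ({x, y} : Set V')) :=
    Module.Finite.span_of_finite K' (Set.toFinite _)
  have h2 := Submodule.finrank_mono h1
  rw [finrank_span_eq_card h, Fintype.card_fin] at h2
  classical
  have h3 := finrank_span_finset_le_card (R := K') ({x, y} : Finset V')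
  have h4 := Finset.card_le_two (a := x) (b := y)
  rw [Set.finrank, Finset.coe_pair] at h3
  omega

theorem LinearIndependent.of_mem_span_triple {u v w x y z : V'}
    (h : LinearIndependent K' ![u, v, w]) (hu : u ∈ Submodule.span K' {x, y, z})
    (hv : v ∈ Submodule.span K' {x, y, z}) (hw : w ∈ Submodule.span K' {x, y, z}) :
    LinearIndependent K' ![x, y, z] := by
  have hr : Set.range ![x, y, z] = {x, y, z} := by
    simp only [Matrix.range_cons, Matrix.range_empty, Set.union_empty, Set.singleton_union]
  have h1 : Submodule.span K' (Set.range ![u, v, w]) ≤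
      Submodule.span K' (Set.range ![x, y, z]) := by
    rw [Submodule.span_le, hr]
    rintro _ ⟨i, rfl⟩
    fin_cases i
    exacts [hu, hv, hw]
  have hfin : Module.Finite K' (Submodule.span K' (Set.range ![x, y, z])) :=
    Module.Finite.span_of_finite K' (Set.toFinite _)
  have h2 := Submodule.finrank_mono h1
  rw [finrank_span_eq_card h] at h2
  exact linearIndependent_iff_card_le_finrank_span.2 h2

/-- Affine coordinates on a projective line relative to the point at infinity `d`. -/
theorem exists_affine_coordinate {K : Type*} [Zero K] [One K] {u d : V'}
    (hu : u ∉ Submodule.span K' {d}) (hd : d ≠ 0) (γ : K → V') (h0 : ∀ s, γ s ≠ 0)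
    (h : ∀ s, γ s ∈ Submodule.span K' {u, d}) (hinf : ∀ s, γ s ∉ Submodule.span K' {d})
    (hγ0 : γ 0 ∈ Submodule.span K' {u}) (hγ1 : γ 1 ∈ Submodule.span K' {u + d}) :
    ∃ τ : K → K', τ 0 = 0 ∧ τ 1 = 1 ∧ ∀ s, γ s ∈ Submodule.span K' {u + τ s • d} := by
  have key : ∀ s, ∃ c : K', γ s ∈ Submodule.span K' {u + c • d} := by
    intro s
    obtain ⟨a, b, hab⟩ := Submodule.mem_span_pair.1 (h s)
    have ha : a ≠ 0 := by
      rintro rfl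
      exact hinf s (Submodule.mem_span_singleton.2 ⟨b, by rw [← hab, zero_smul, zero_add]⟩)
    refine ⟨a⁻¹ * b, Submodule.mem_span_singleton.2 ⟨a, ?_⟩⟩
    rw [smul_add, smul_smul, mul_inv_cancel_left₀ ha, hab]
  choose τ hτ using key
  have hmem : ∀ c : K', c • d ∈ Submodule.span K' {d} := fun c =>
    Submodule.mem_span_singleton.2 ⟨c, rfl⟩
  refine ⟨τ, ?_, ?_, hτ⟩
  · have := eq_of_mem_span_singleton_add hu (hmem _) (Submodule.zero_mem _) (h0 0) (hτ 0)
      (by simpa using hγ0)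
    exact (smul_eq_zero.1 this).resolve_right hd
  · have := eq_of_mem_span_singleton_add hu (hmem _) (hmem 1) (h0 1) (hτ 1) (by simpa using hγ1)
    exact smul_left_injective K' hd this

end LinearAlgebra

/-! ### Morphisms on an affine plane -/

section Plane

variable {K : Type*} {K' : Type*} {V' : Type*} [DivisionRing K] [DivisionRing K']
  [AddCommGroup V'] [Module K' V']

/-- Vectors representing the images of the points of the affine plane `K × K` under a morphism to
a projective space whose image is not collinear. -/
structure IsPlaneLift (K' : Type*) {V' : Type*} [DivisionRing K'] [AddCommGroup V'] [Module K' V']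
    (G : K → K → V') : Prop where
  ne_zero : ∀ t s, G t s ≠ 0
  mem : ∀ (W : Submodule K' V') (t s t₁ s₁ t₂ s₂ : K), G t s ∈ W → G t₁ s₁ ∈ W → G t₂ s₂ ∈ W →
    ∀ a b : K, G (t + a * (t₁ - t) + b * (t₂ - t)) (s + a * (s₁ - s) + b * (s₂ - s)) ∈ W
  linearIndependent : LinearIndependent K' ![G 0 0, G 1 0, G 0 1]

namespace IsPlaneLift

variable {G : K → K → V'} (hG : IsPlaneLift K' G)

include hG

/-- Two points of a column and one point off it span the affine plane. Together with
`not_forall_mem_pair` this excludes degenerate positions. -/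
theorem mem_of_column {W : Submodule K' V'} {t₀ t s : K} (h0 : G t₀ 0 ∈ W) (h1 : G t₀ 1 ∈ W)
    (ht : t ≠ t₀) (h : G t s ∈ W) (t' s' : K) : G t' s' ∈ W := by
  have hd : t - t₀ ≠ 0 := sub_ne_zero.2 ht
  convert hG.mem W t₀ 0 t₀ 1 t s h0 h1 h (s' - (t' - t₀) * (t - t₀)⁻¹ * s)
    ((t' - t₀) * (t - t₀)⁻¹) using 2
  · rw [inv_mul_cancel_right₀ hd]; simp
  · simp

theorem not_forall_mem_pair (x y : V') : ¬ ∀ t s, G t s ∈ Submodule.span K' {x, y} := fun h =>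
  hG.linearIndependent.not_forall_mem_span_pair x y (h _ _) (h _ _) (h _ _)

theorem mem_line {W : Submodule K' V'} {t s t' s' : K} (h : G t s ∈ W) (h' : G t' s' ∈ W) (a : K) :
    G (t + a * (t' - t)) (s + a * (s' - s)) ∈ W := by
  simpa using hG.mem W t s t' s' t' s' h h' h' a 0

/-- A frame in which the unit square is mapped to a parallelogram. -/
theorem exists_frame : ∃ e d : V', LinearIndependent K' ![G 0 0, e, d] ∧
    G 1 0 ∈ Submodule.span K' {e} ∧ G 0 1 ∈ Submodule.span K' {G 0 0 + d} ∧
    G 1 1 ∈ Submodule.span K' {e + d} := by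
  have h11 : G 1 1 ∈ Submodule.span K' {G 0 0, G 1 0, G 0 1} :=
    hG.mem_of_column (t₀ := 0) (t := 1) (s := 0) (Submodule.subset_span (by simp))
      (Submodule.subset_span (by simp)) one_ne_zero (Submodule.subset_span (by simp)) 1 1
  obtain ⟨α, β, γ, h⟩ := Submodule.mem_span_triple.1 h11
  -- If a coefficient vanished, three corners of the square would have collinear images, hence so
  -- would the whole plane.
  have hα : α ≠ 0 := by
    rintro rfl
    rw [zero_smul, zero_add] at h
    refine hG.not_forall_mem_pair (G 1 0) (G 0 1) (hG.mem_of_column (t₀ := 1) (t := 0) (s := 1)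
      (Submodule.subset_span (by simp)) (Submodule.mem_span_pair.2 ⟨_, _, h⟩) zero_ne_one
      (Submodule.subset_span (by simp)))
  have hβ : β ≠ 0 := by
    rintro rfl
    rw [zero_smul, add_zero] at h
    refine hG.not_forall_mem_pair (G 0 0) (G 0 1) (hG.mem_of_column (t₀ := 0) (t := 1) (s := 1)
      (Submodule.subset_span (by simp)) (Submodule.subset_span (by simp)) one_ne_zero
      (Submodule.mem_span_pair.2 ⟨_, _, h⟩))
  have hγ : γ ≠ 0 := by
    rintro rfl
    rw [zero_smul, add_zero] at h
    refine hG.not_forall_mem_pair (G 0 0) (G 1 0) (hG.mem_of_column (t₀ := 1) (t := 0) (s := 0)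
      (Submodule.subset_span (by simp)) (Submodule.mem_span_pair.2 ⟨_, _, h⟩) zero_ne_one
      (Submodule.subset_span (by simp)))
  -- Scaled so that `e + d` is a multiple of `G 1 1`; the lines carrying the columns `t = 0` and `t
  -- = 1` then meet in `d`.
  set e : V' := -((α⁻¹ * β) • G 1 0) with he
  set d : V' := -((α⁻¹ * γ) • G 0 1) - G 0 0 with hd
  have e10 : G 1 0 = (-(β⁻¹ * α)) • e := by
    rw [he, neg_smul, smul_neg, neg_neg, smul_smul, mul_assoc, mul_inv_cancel_left₀ hα,
      inv_mul_cancel₀ hβ, one_smul]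
  have e01 : G 0 1 = (-(γ⁻¹ * α)) • (G 0 0 + d) := by
    rw [hd, add_sub_cancel, neg_smul, smul_neg, neg_neg, smul_smul, mul_assoc,
      mul_inv_cancel_left₀ hα, inv_mul_cancel₀ hγ, one_smul]
  have e11 : G 1 1 = (-α) • (e + d) := by
    rw [← h, he, hd]
    simp only [smul_add, smul_sub, smul_neg, neg_smul, neg_neg, smul_smul,
      mul_inv_cancel_left₀ hα, neg_mul]
    abel
  refine ⟨e, d, hG.linearIndependent.of_mem_span_triple (Submodule.subset_span (by simp)) ?_ ?_,
    Submodule.mem_span_singleton.2 ⟨_, e10.symm⟩, Submodule.mem_span_singleton.2 ⟨_, e01.symm⟩,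
    Submodule.mem_span_singleton.2 ⟨_, e11.symm⟩⟩
  · rw [e10]
    exact Submodule.smul_mem _ _ (Submodule.subset_span (by simp))
  · rw [e01]
    exact Submodule.smul_mem _ _ (Submodule.add_mem _ (Submodule.subset_span (by simp))
      (Submodule.subset_span (by simp)))

/-- A morphism from an affine plane to a projective space with noncollinear image is given by a
semiaffine map. -/
theorem exists_semiaffine (hK : 4 ≤ Cardinal.mk K ∨ (Cardinal.mk K = 3 ∧ CharP K' 3)) :
    ∃ (σ : K →+* K') (d₁ d₂ : V'), ∀ t s,
      G t s ∈ Submodule.span K' {G 0 0 + σ t • d₁ + σ s • d₂} := by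
  obtain ⟨e, d, hind, h10, h01, h11⟩ := hG.exists_frame
  set b := G 0 0 with hb
  have hd0 : d ≠ 0 := hind.ne_zero 2
  have hbd : b ∉ Submodule.span K' {d} := fun h => by
    obtain ⟨c, hc⟩ := Submodule.mem_span_singleton.1 h
    have := (hind.triple_unique (a := 1) (b := 0) (c := 0) (a' := 0) (b' := 0) (c' := c)
      (by simp [hc])).1
    exact one_ne_zero this
  have hed : e ∉ Submodule.span K' {d} := fun h => by
    obtain ⟨c, hc⟩ := Submodule.mem_span_singleton.1 h
    have := (hind.triple_unique (a := 0) (b := 1) (c := 0) (a' := 0) (b' := 0) (c' := c)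
      (by simp [hc])).2.1
    exact one_ne_zero this
  have hbdm : ∀ c : K', b + c • d ∈ Submodule.span K' {b, d} := fun c =>
    Submodule.mem_span_pair.2 ⟨1, c, by simp⟩
  have hedm : ∀ c : K', e + c • d ∈ Submodule.span K' {e, d} := fun c =>
    Submodule.mem_span_pair.2 ⟨1, c, by simp⟩
  have h01' : G 0 1 ∈ Submodule.span K' {b, d} :=
    (Submodule.span_singleton_le_iff_mem _ _).2 (by simpa using hbdm 1) h01
  have h10' : G 1 0 ∈ Submodule.span K' {e, d} :=
    (Submodule.span_singleton_le_iff_mem _ _).2 (by simpa using hedm 0) h10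
  have h11' : G 1 1 ∈ Submodule.span K' {e, d} :=
    (Submodule.span_singleton_le_iff_mem _ _).2 (by simpa using hedm 1) h11
  -- Each column avoids the line carrying the other, hence avoids `d`, so affine coordinates exist
  -- on both.
  have hcol1 : ∀ t s, t ≠ 1 → G t s ∉ Submodule.span K' {e, d} := fun t s ht h =>
    hG.not_forall_mem_pair e d (hG.mem_of_column h10' h11' ht h)
  have hcol0 : ∀ t s, t ≠ 0 → G t s ∉ Submodule.span K' {b, d} := fun t s ht h =>
    hG.not_forall_mem_pair b d
      (hG.mem_of_column (t₀ := 0) (Submodule.subset_span (by simp [hb])) h01' ht h)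
  have hle : ∀ x : V', Submodule.span K' {d} ≤ Submodule.span K' {x, d} := fun x =>
    Submodule.span_mono (by simp)
  obtain ⟨τ, hτ0, hτ1, hτ⟩ := exists_affine_coordinate hbd hd0 (fun s => G 0 s)
    (fun s => hG.ne_zero 0 s)
    (fun s => by simpa using hG.mem_line (t := 0) (s := 0) (Submodule.subset_span (by simp [hb])) h01' s)
    (fun s h => hcol1 0 s zero_ne_one (hle _ h)) (Submodule.mem_span_singleton_self _) h01
  obtain ⟨θ, hθ0, hθ1, hθ⟩ := exists_affine_coordinate hed hd0 (fun s => G 1 s)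
    (fun s => hG.ne_zero 1 s)
    (fun s => by simpa using hG.mem_line h10' h11' s)
    (fun s h => hcol0 1 s one_ne_zero (hle _ h)) h10 h11
  -- If `(1, 1)` and `(1, r)` had the same image for some `r ≠ 1`, the whole column, including `(1,
  -- 0)`, would collapse to one point.
  have hθinj : ∀ r, θ r = 1 → r = 1 := by
    intro r hr
    by_contra hne
    have h1 := hθ r
    rw [hr, one_smul] at h1
    have h2 := hG.mem_line h11 h1 ((1 - r)⁻¹)
    have h3 : (1 : K) + (1 - r)⁻¹ * (r - 1) = 0 := by
      rw [← neg_sub 1 r, mul_neg, inv_mul_cancel₀ (sub_ne_zero.2 (Ne.symm hne)), add_neg_cancel]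
    rw [h3, sub_self, mul_zero, add_zero] at h2
    have := eq_of_mem_span_singleton_add hed (Submodule.zero_mem _)
      (Submodule.mem_span_singleton_self d) (hG.ne_zero 1 0) (by simpa using h10) h2
    exact hd0 this.symm
  -- The point `(t, s)` is on the line joining `(0, z)` to `(1, z')`.
  have hmeet : ∀ t s z z', (1 - t) * z + t * z' = s → ∃ α β : K',
      α • b + β • e + (α * τ z + β * θ z') • d = G t s := by
    rintro t s z z' rfl
    have h1 := hG.mem_line (W := Submodule.span K' {b + τ z • d, e + θ z' • d})
      (Submodule.span_mono (by simp) (hτ z)) (Submodule.span_mono (by simp) (hθ z')) t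
    rw [show (0 : K) + t * (1 - 0) = t by simp,
      show z + t * (z' - z) = (1 - t) * z + t * z' by noncomm_ring] at h1
    obtain ⟨α, β, h⟩ := Submodule.mem_span_pair.1 h1
    refine ⟨α, β, ?_⟩
    rw [← h, smul_add, smul_add, smul_smul, smul_smul, add_smul]
    abel
  -- The lines joining `(0, z)` to `(1, r + n * z)` all pass through `((1 - n)⁻¹, (1 - n)⁻¹ * r)`,
  -- the centre of the perspectivity.
  have hrel : ∀ n r z : K, n ≠ 1 →
      (1 - (1 - n)⁻¹) * z + (1 - n)⁻¹ * (r + n * z) = (1 - n)⁻¹ * r := by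
    intro n r z hn
    have : (1 - n)⁻¹ * (1 - n) = 1 := inv_mul_cancel₀ (sub_ne_zero.2 (Ne.symm hn))
    calc _ = (1 - n)⁻¹ * r + z - ((1 - n)⁻¹ * (1 - n)) * z := by noncomm_ring
      _ = _ := by rw [this]; simp
  obtain ⟨σ, hσ⟩ := exists_ringHom_of_affine_relation hK τ θ hτ0 hτ1 hθ0 hθ1 hθinj (by
    intro n hn0 hn1 r
    obtain ⟨α, β, h0⟩ := hmeet _ _ 0 (r + n * 0) (hrel n r 0 hn1)
    have hα : α ≠ 0 := by
      rintro rfl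
      refine hcol1 _ _ ?_ (Submodule.mem_span_pair.2
        ⟨β, 0 * τ 0 + β * θ (r + n * 0), by rw [← h0, zero_smul, zero_add]⟩)
      intro h
      rw [inv_eq_one, sub_eq_self] at h
      exact hn0 h
    refine ⟨α⁻¹ * (β * θ r), -(α⁻¹ * β), fun z => ?_⟩
    obtain ⟨α', β', h⟩ := hmeet _ _ z (r + n * z) (hrel n r z hn1)
    -- The centre is fixed, so `α`, `β` and `α * τ z + β * θ (r + n * z)` do not depend on `z`.
    obtain ⟨rfl, rfl, h2⟩ := hind.triple_unique (h.trans h0.symm)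
    rw [hτ0, mul_zero, zero_add, mul_zero, add_zero] at h2
    rw [← h2, mul_add, inv_mul_cancel_left₀ hα, ← mul_assoc, neg_mul, add_neg_cancel_right])
  refine ⟨σ, e - b, d, fun t s => ?_⟩
  rcases eq_or_ne t 0 with rfl | ht0
  · simpa [(hσ s).1] using hτ s
  rcases eq_or_ne t 1 with rfl | ht1
  · simpa [(hσ s).2] using hθ s
  have hn1 : (1 : K) - t⁻¹ ≠ 1 := by simpa using ht0
  have hrel' : ∀ z, (1 - t) * z + t * (t⁻¹ * s + (1 - t⁻¹) * z) = s := by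
    intro z
    have := hrel (1 - t⁻¹) (t⁻¹ * s) z hn1
    rwa [sub_sub_cancel, inv_inv, mul_inv_cancel_left₀ ht0] at this
  -- Two lines through `(t, s)`, one from `(0, 0)` and one from `(0, 1)`, determine the ratio of the
  -- coefficients.
  obtain ⟨α, β, h0⟩ := hmeet _ _ 0 _ (hrel' 0)
  obtain ⟨α', β', h1⟩ := hmeet _ _ 1 _ (hrel' 1)
  obtain ⟨rfl, rfl, h2⟩ := hind.triple_unique (h1.trans h0.symm)
  simp only [(hσ _).1, (hσ _).2, map_zero, map_one, mul_zero, mul_one, add_zero, zero_add,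
    map_add, map_mul, map_sub, map_inv₀] at h0 h2
  have hσt : σ t ≠ 0 := (map_ne_zero σ).2 ht0
  have hα : α' = β' * (σ t)⁻¹ - β' := by
    rw [mul_add, ← add_assoc, add_right_comm, add_eq_right, mul_sub, mul_one] at h2
    rw [eq_neg_of_add_eq_zero_left h2, neg_sub]
  refine Submodule.mem_span_singleton.2 ⟨β' * (σ t)⁻¹, ?_⟩
  rw [← h0, hα]
  simp only [smul_add, smul_sub, smul_smul, sub_smul, mul_assoc, inv_mul_cancel₀ hσt, mul_one]
  abel

end IsPlaneLift

end Plane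

/-! ### Affine spaces of arbitrary dimension: gluing the planes -/

section Affine

variable {K K' U V' : Type*} [DivisionRing K] [AddCommGroup U] [Module K U]
  [DivisionRing K'] [AddCommGroup V'] [Module K' V']

theorem pair_unique {b d : V'} (hb : b ≠ 0) (hd : d ∉ Submodule.span K' {b}) {α β α' β' : K'}
    (h : α • b + β • d = α' • b + β' • d) : α = α' ∧ β = β' := by
  have e : (β - β') • d = (α' - α) • b := by
    rw [sub_smul, sub_smul, sub_eq_sub_iff_add_eq_add, add_comm, h]
  have hβ : β = β' := by
    by_contra hne
    refine hd (((Submodule.span K' {b}).smul_mem_iff (sub_ne_zero.2 hne)).1 ?_)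
    rw [e]
    exact Submodule.smul_mem _ _ (Submodule.mem_span_singleton_self b)
  rw [hβ, sub_self, zero_smul, eq_comm, smul_eq_zero] at e
  exact ⟨(sub_eq_zero.1 (e.resolve_right hb)).symm, hβ⟩

/-- Vectors representing the images of the points of an affine space under a morphism to a
projective space. -/
structure IsFlatLift (K K' : Type*) {U V' : Type*} [DivisionRing K] [AddCommGroup U] [Module K U]
    [DivisionRing K'] [AddCommGroup V'] [Module K' V'] (g : U → V') : Prop where
  ne_zero : ∀ x, g x ≠ 0
  mem : ∀ (W : Submodule K' V') (p x y : U), g p ∈ W → g (p + x) ∈ W → g (p + y) ∈ W →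
    ∀ a b : K, g (p + a • x + b • y) ∈ W

/-- The restriction of `g` to the line through `0` and `x` is semiaffine with direction `d`. -/
structure IsSemiaffineAlong (g : U → V') (σ : K →+* K') (x : U) (d : V') : Prop where
  notMem : d ∉ Submodule.span K' {g 0}
  mem : ∀ t : K, g (t • x) ∈ Submodule.span K' {g 0 + σ t • d}

theorem IsSemiaffineAlong.mem_one {g : U → V'} {σ : K →+* K'} {x : U} {d : V'}
    (h : IsSemiaffineAlong g σ x d) : g x ∈ Submodule.span K' {g 0 + d} := by
  simpa using h.mem 1

namespace IsFlatLift

variable {g : U → V'} (hg : IsFlatLift K K' g)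

include hg

/-- The direction of a semiaffine map on a line is determined by the map. -/
theorem semiaffine_unique (hK : 3 ≤ Cardinal.mk K) {σ σ' : K →+* K'} {x : U} {d d' : V'}
    (h : IsSemiaffineAlong g σ x d) (h' : IsSemiaffineAlong g σ' x d') : σ = σ' ∧ d = d' := by
  obtain ⟨c, hc⟩ := Submodule.mem_span_singleton.1 h.mem_one
  obtain ⟨c', hc'⟩ := Submodule.mem_span_singleton.1 h'.mem_one
  have hc0' : c' ≠ 0 := by rintro rfl; exact hg.ne_zero x (by rw [← hc', zero_smul])
  obtain ⟨m, hm⟩ : ∃ m : K', g 0 + d' = m • (g 0 + d) := by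
    refine ⟨c'⁻¹ * c, ?_⟩
    rw [mul_smul, hc, ← hc', inv_smul_smul₀ hc0']
  have hd' : d' = (m - 1) • g 0 + m • d := by
    rw [sub_smul, one_smul, sub_add_eq_add_sub, ← smul_add, ← hm, add_sub_cancel_left]
  -- Comparing at `s⁻¹ • x` instead of `s • x` makes the relation affine in `σ s` and `σ' s`.
  have key : ∀ s, s ≠ 0 → σ' s + (m - 1) = m * σ s := by
    intro s hs
    obtain ⟨k, hk⟩ := Submodule.mem_span_singleton.1 (h.mem s⁻¹)
    obtain ⟨k', hk'⟩ := Submodule.mem_span_singleton.1 (h'.mem s⁻¹)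
    have hk0 : k' ≠ 0 := by rintro rfl; exact hg.ne_zero _ (by rw [← hk', zero_smul])
    have hs' : σ' s ≠ 0 := (map_ne_zero σ').2 hs
    have hs0 : σ s ≠ 0 := (map_ne_zero σ).2 hs
    rw [← hk', hd'] at hk
    have e : k • g 0 + (k * σ s⁻¹) • d =
        (k' + k' * σ' s⁻¹ * (m - 1)) • g 0 + (k' * σ' s⁻¹ * m) • d := by
      simp only [smul_add, smul_smul] at hk
      rw [hk, add_smul, add_assoc]
      simp only [mul_assoc]
    obtain ⟨e1, e2⟩ := pair_unique (hg.ne_zero 0) h.notMem e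
    rw [e1, map_inv₀, map_inv₀, mul_inv_eq_iff_eq_mul₀ hs0] at e2
    have e3 : k' * (σ' s)⁻¹ * (σ' s + (m - 1)) = k' * (σ' s)⁻¹ * (m * σ s) := by
      rw [mul_add, inv_mul_cancel_right₀ hs', e2, mul_assoc _ m]
    exact mul_left_cancel₀ (mul_ne_zero hk0 (inv_ne_zero hs')) e3
  have hm1 : m = 1 := by
    -- The sum of the relations at `1` and `r` differs from the relation at `1 + r` by `m - 1`.
    obtain ⟨r, hr0, hr1⟩ := exists_notMem_of_three_le hK 0 (-1)
    have e1 := key 1 one_ne_zero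
    have e2 := key r hr0
    have e3 := key (1 + r) (fun h => hr1 (eq_neg_of_add_eq_zero_right h))
    rw [map_add, map_add, mul_add, ← e1, ← e2, add_add_add_comm, add_right_inj, eq_comm,
      add_eq_left] at e3
    exact sub_eq_zero.1 e3
  refine ⟨RingHom.ext fun s => ?_, by rw [hd', hm1, sub_self, zero_smul, zero_add, one_smul]⟩
  rcases eq_or_ne s 0 with rfl | hs
  · simp
  · simpa [hm1, eq_comm] using key s hs

/-- The points whose image is on the line joining the images of `0` and `x`. -/
def pencil (x : U) : Submodule K U where
  carrier := {u | g u ∈ Submodule.span K' {g 0, g x}}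
  zero_mem' := Submodule.subset_span (by simp)
  add_mem' {u v} hu hv := by
    simpa using hg.mem (Submodule.span K' {g 0, g x}) 0 u v (Submodule.subset_span (by simp))
      (by simpa using hu) (by simpa using hv) 1 1
  smul_mem' a u hu := by
    simpa using hg.mem (Submodule.span K' {g 0, g x}) 0 u u (Submodule.subset_span (by simp))
      (by simpa using hu) (by simpa using hu) a 0

theorem mem_pencil {u x : U} : u ∈ hg.pencil x ↔ g u ∈ Submodule.span K' {g 0, g x} := Iff.rfl

theorem mem_pencil_zero {u : U} : u ∈ hg.pencil 0 ↔ g u ∈ Submodule.span K' {g 0} := by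
  rw [mem_pencil, Set.pair_eq_singleton]

theorem self_mem_pencil (x : U) : x ∈ hg.pencil x := Submodule.subset_span (by simp)

theorem pencil_mono {u x : U} (h : u ∈ hg.pencil x) : hg.pencil u ≤ hg.pencil x := by
  intro w hw
  rw [mem_pencil] at hw ⊢
  refine (Submodule.span_le.2 ?_) hw
  rintro _ (rfl | rfl)
  exacts [Submodule.subset_span (by simp), h]

theorem pencil_zero_le (x : U) : hg.pencil 0 ≤ hg.pencil x := hg.pencil_mono (zero_mem _)

theorem mem_pencil_exchange {u x : U} (h : u ∈ hg.pencil x) (hu : u ∉ hg.pencil 0) :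
    x ∈ hg.pencil u := by
  rw [mem_pencil, Set.pair_comm] at h ⊢
  rw [mem_pencil_zero] at hu
  exact mem_span_insert_exchange h hu

theorem linearIndependent {x y : U} (hx : x ∉ hg.pencil 0) (hy : y ∉ hg.pencil x) :
    LinearIndependent K' ![g 0, g x, g y] := by
  rw [mem_pencil_zero] at hx
  rw [linearIndependent_triple_iff]
  intro a b c h
  have hc : c = 0 := by
    by_contra hc
    refine hy (((Submodule.span K' {g 0, g x}).smul_mem_iff hc).1 ?_)
    rw [eq_neg_of_add_eq_zero_right h]
    exact Submodule.neg_mem _ (Submodule.mem_span_pair.2 ⟨a, b, rfl⟩)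
  subst hc
  have := pair_unique (hg.ne_zero 0) hx (α := a) (β := b) (α' := 0) (β' := 0) (by simpa using h)
  exact ⟨this.1, this.2, rfl⟩

theorem notMem_pencil_zero {σ : K →+* K'} {x : U} {d : V'} (h : IsSemiaffineAlong g σ x d) :
    x ∉ hg.pencil 0 := by
  rw [mem_pencil_zero]
  intro hx
  have := eq_of_mem_span_singleton_add (D := Submodule.span K' {d}) (u := g 0) (w := 0) (w' := d)
    (v := g x) (fun h0 => h.notMem ?_) (Submodule.zero_mem _) (Submodule.mem_span_singleton_self d)
    (hg.ne_zero x) (by simpa using hx) h.mem_one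
  · exact h.notMem (this ▸ Submodule.zero_mem _)
  · have h0' : g 0 ∈ Submodule.span K' (insert d ∅) := by simpa using h0
    simpa using mem_span_insert_exchange h0' (by simpa using hg.ne_zero 0)

theorem isPlaneLift {x y : U} (hx : x ∉ hg.pencil 0) (hy : y ∉ hg.pencil x) :
    IsPlaneLift K' fun t s : K => g (t • x + s • y) where
  ne_zero t s := hg.ne_zero _
  mem W t s t₁ s₁ t₂ s₂ h h₁ h₂ a b := by
    convert hg.mem W (t • x + s • y) ((t₁ - t) • x + (s₁ - s) • y)
      ((t₂ - t) • x + (s₂ - s) • y) h ?_ ?_ a b using 2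
    · simp only [add_smul, smul_add, mul_smul]; abel
    · convert h₁ using 2; simp only [sub_smul]; abel
    · convert h₂ using 2; simp only [sub_smul]; abel
  linearIndependent := by simpa using hg.linearIndependent hx hy

variable (hK : 4 ≤ Cardinal.mk K ∨ (Cardinal.mk K = 3 ∧ CharP K' 3))

include hK

/-- The plane case applies to the plane through `0`, `x`, `y`, and one `σ` then serves all its lines
through `0`. -/
theorem exists_semiaffine_plane {x y : U} (hx : x ∉ hg.pencil 0) (hy : y ∉ hg.pencil x) :
    ∃ (σ : K →+* K') (d₁ d₂ : V'), LinearIndependent K' ![g 0, d₁, d₂] ∧ ∀ t s,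
      ¬(t = 0 ∧ s = 0) → IsSemiaffineAlong g σ (t • x + s • y) (σ t • d₁ + σ s • d₂) := by
  obtain ⟨σ, d₁, d₂, h⟩ := (hg.isPlaneLift hx hy).exists_semiaffine hK
  simp only [zero_smul, add_zero] at h
  have hmem : ∀ a b : K', g 0 + a • d₁ + b • d₂ ∈ Submodule.span K' {g 0, d₁, d₂} := fun a b =>
    Submodule.mem_span_triple.2 ⟨1, a, b, by simp⟩
  have hind : LinearIndependent K' ![g 0, d₁, d₂] :=
    (hg.linearIndependent hx hy).of_mem_span_triple (Submodule.subset_span (by simp))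
      ((Submodule.span_singleton_le_iff_mem _ _).2 (hmem 1 0) (by simpa using h 1 0))
      ((Submodule.span_singleton_le_iff_mem _ _).2 (hmem 0 1) (by simpa using h 0 1))
  refine ⟨σ, d₁, d₂, hind, fun t s hts => ⟨fun hd => ?_, fun k => ?_⟩⟩
  · obtain ⟨c, hc⟩ := Submodule.mem_span_singleton.1 hd
    have := hind.triple_unique (a := 0) (b := σ t) (c := σ s) (a' := c) (b' := 0) (c' := 0)
      (by simp [hc])
    exact hts ⟨(map_eq_zero σ).1 this.2.1, (map_eq_zero σ).1 this.2.2⟩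
  · simpa only [smul_add, smul_smul, map_mul, add_assoc] using h (k * t) (k * s)

variable (hspan : ∀ a c : V', ∃ x, g x ∉ Submodule.span K' {a, c})

include hspan

/-- All lines through `0` on which `g` is not constant have the same ring morphism. -/
theorem exists_ringHom : ∃ σ : K →+* K', ∀ x, x ∉ hg.pencil 0 → ∃ d, IsSemiaffineAlong g σ x d := by
  have hK3 : 3 ≤ Cardinal.mk K := hK.elim (le_trans (by norm_num)) fun h => h.1.ge
  have key : ∀ {x y : U}, x ∉ hg.pencil 0 → y ∉ hg.pencil x → ∀ {σ : K →+* K'} {d : V'},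
      IsSemiaffineAlong g σ x d → ∃ d', IsSemiaffineAlong g σ y d' := by
    intro x y hx hy σ d hd
    obtain ⟨σ', d₁, d₂, -, h⟩ := hg.exists_semiaffine_plane hK hx hy
    have h1 := h 1 0 (by simp)
    have h2 := h 0 1 (by simp)
    simp only [one_smul, zero_smul, add_zero, zero_add, map_one, map_zero] at h1 h2
    obtain ⟨rfl, -⟩ := hg.semiaffine_unique hK3 hd h1
    exact ⟨d₂, h2⟩
  obtain ⟨x₀, hx₀⟩ : ∃ x₀, x₀ ∉ hg.pencil 0 := hspan _ _
  obtain ⟨y₀, hy₀⟩ : ∃ y₀, y₀ ∉ hg.pencil x₀ := hspan _ _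
  obtain ⟨σ, d₁, d₂, -, h⟩ := hg.exists_semiaffine_plane hK hx₀ hy₀
  have h1 := h 1 0 (by simp)
  have h2 := h 0 1 (by simp)
  simp only [one_smul, zero_smul, add_zero, zero_add, map_one, map_zero] at h1 h2
  refine ⟨σ, fun x hx => ?_⟩
  by_cases hxx : x ∈ hg.pencil x₀
  -- Here `x` and `x₀` need not span a plane with noncollinear image, but `y₀` and `x` do.
  · exact key (hg.notMem_pencil_zero h2) (fun hxy => hy₀
      (hg.pencil_mono hxx (hg.mem_pencil_exchange hxy hx))) h2
  · exact key hx₀ hxx h1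

/-- A morphism from an affine space to a projective space with noncollinear image is given by a
semiaffine map. -/
theorem exists_semilinear : ∃ (σ : K →+* K') (Φ : U →ₛₗ[σ] V'), ∀ x,
    g x ∈ Submodule.span K' {g 0 + Φ x} := by
  classical
  have hK3 : 3 ≤ Cardinal.mk K := hK.elim (le_trans (by norm_num)) fun h => h.1.ge
  obtain ⟨σ, hσ⟩ := hg.exists_ringHom hK hspan
  choose! d hd using hσ
  have hout : ∀ x, ∃ z, z ∉ hg.pencil x := fun x => hspan _ _
  have hplane : ∀ x y, x ∉ hg.pencil 0 → y ∉ hg.pencil x →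
      LinearIndependent K' ![g 0, d x, d y] ∧
      ∀ t s, ¬(t = 0 ∧ s = 0) → d (t • x + s • y) = σ t • d x + σ s • d y := by
    intro x y hx hy
    obtain ⟨σ', d₁, d₂, hind, h⟩ := hg.exists_semiaffine_plane hK hx hy
    have h1 := h 1 0 (by simp)
    have h2 := h 0 1 (by simp)
    simp only [one_smul, zero_smul, add_zero, zero_add, map_one, map_zero] at h1 h2
    obtain ⟨rfl, rfl⟩ := hg.semiaffine_unique hK3 (hd x hx) h1
    obtain ⟨-, rfl⟩ := hg.semiaffine_unique hK3 (hd y (hg.notMem_pencil_zero h2)) h2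
    exact ⟨hind, fun t s hts => (hg.semiaffine_unique hK3
      (hd _ (hg.notMem_pencil_zero (h t s hts))) (h t s hts)).2⟩
  have hadd : ∀ x y, x ∉ hg.pencil 0 → y ∉ hg.pencil x → d (x + y) = d x + d y := fun x y hx hy =>
    by simpa using (hplane x y hx hy).2 1 1 (by simp)
  have hsmul : ∀ (t : K) x, t ≠ 0 → x ∉ hg.pencil 0 → d (t • x) = σ t • d x := by
    intro t x ht hx
    obtain ⟨y, hy⟩ := hout x
    simpa using (hplane x y hx hy).2 t 0 (by simp [ht])
  -- Both sides come from splitting `d (x + z + z')` in two ways.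
  have hquot : ∀ x z z', x ∈ hg.pencil 0 → z ∉ hg.pencil 0 → z' ∉ hg.pencil z →
      d (x + z) - d z = d (x + z') - d z' := by
    intro x z z' hx hz hz'
    have hz'0 : z' ∉ hg.pencil 0 := fun h => hz' (hg.pencil_zero_le z h)
    have hzz' : z ∉ hg.pencil z' := fun h => hz' (hg.mem_pencil_exchange h hz)
    have hle : ∀ w, hg.pencil (x + w) ≤ hg.pencil w := fun w =>
      hg.pencil_mono (add_mem (hg.pencil_zero_le w hx) (hg.self_mem_pencil w))
    have h1 := hadd (x + z) z' (fun h => hz ((add_mem_cancel_left hx).1 h))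
      (fun h => hz' (hle z h))
    have h2 := hadd (x + z') z (fun h => hz'0 ((add_mem_cancel_left hx).1 h))
      (fun h => hzz' (hle z' h))
    rw [add_right_comm, h1] at h2
    exact sub_eq_sub_iff_add_eq_add.2 h2
  obtain ⟨z₀, hz₀⟩ := hout 0
  -- On `pencil 0` the value is the one imposed by additivity with `z₀`; `hquot` makes it
  -- independent of that choice.
  set Φ : U → V' := fun x => if x ∈ hg.pencil 0 then d (x + z₀) - d z₀ else d x with hΦ
  have hΦd : ∀ x, x ∉ hg.pencil 0 → Φ x = d x := fun x hx => if_neg hx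
  have key : ∀ x z, z ∉ hg.pencil x → d (x + z) = Φ x + d z := by
    intro x z hz
    by_cases hx : x ∈ hg.pencil 0
    · have hz0 : z ∉ hg.pencil 0 := fun h => hz (hg.pencil_zero_le x h)
      rw [hΦ]
      simp only [if_pos hx]
      rw [← sub_eq_iff_eq_add]
      by_cases hzz : z ∈ hg.pencil z₀
      · obtain ⟨z', hz'⟩ := hout z₀
        rw [hquot x z₀ z' hx hz₀ hz',
          hquot x z z' hx hz0 (fun h => hz' (hg.pencil_mono hzz h))]
      · exact (hquot x z₀ z hx hz₀ hzz).symm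
    · rw [hΦd x hx, hadd x z hx hz]
  have hΦadd : ∀ x y, Φ (x + y) = Φ x + Φ y := by
    intro x y
    -- If `x` and `y` lie over one line, a `z` outside it reduces the claim to `key`; otherwise
    -- `hadd` applies directly.
    by_cases hw : ∃ w, w ∉ hg.pencil 0 ∧ x ∈ hg.pencil w ∧ y ∈ hg.pencil w
    · obtain ⟨w, -, hx, hy⟩ := hw
      obtain ⟨z, hz⟩ := hout w
      have h1 := key (x + y) z (fun h => hz (hg.pencil_mono (add_mem hx hy) h))
      have h2 := key x (y + z) (fun h => hz ((add_mem_cancel_left hy).1 (hg.pencil_mono hx h)))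
      have h3 := key y z (fun h => hz (hg.pencil_mono hy h))
      rw [add_assoc, h2, h3, ← add_assoc] at h1
      exact (add_right_cancel h1).symm
    · have hx : x ∉ hg.pencil 0 := by
        intro hx
        by_cases hy : y ∈ hg.pencil 0
        · exact hw ⟨z₀, hz₀, hg.pencil_zero_le _ hx, hg.pencil_zero_le _ hy⟩
        · exact hw ⟨y, hy, hg.pencil_zero_le _ hx, hg.self_mem_pencil y⟩
      have hy : y ∉ hg.pencil x := fun hy => hw ⟨x, hx, hg.self_mem_pencil x, hy⟩
      rw [hΦd x hx, hΦd y (fun h => hy (hg.pencil_zero_le x h)), hΦd, hadd x y hx hy]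
      exact fun h => hy ((add_mem_cancel_left (hg.self_mem_pencil x)).1 (hg.pencil_zero_le x h))
  have hΦsmul : ∀ (t : K) x, Φ (t • x) = σ t • Φ x := by
    intro t x
    rcases eq_or_ne t 0 with rfl | ht
    · have := key 0 z₀ hz₀
      rw [zero_add, right_eq_add] at this
      rw [zero_smul, map_zero, zero_smul, this]
    · obtain ⟨z, hz⟩ := hout x
      have hz0 : z ∉ hg.pencil 0 := fun h => hz (hg.pencil_zero_le x h)
      have h1 := key (t • x) (t • z) (fun h => hz (((hg.pencil x).smul_mem_iff ht).1
        (hg.pencil_mono (Submodule.smul_mem _ t (hg.self_mem_pencil x)) h)))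
      rw [← smul_add, hsmul t z ht hz0, hsmul t (x + z) ht, key x z hz, smul_add] at h1
      · exact (add_right_cancel h1).symm
      · exact fun h => hz ((add_mem_cancel_left (hg.self_mem_pencil x)).1 (hg.pencil_zero_le x h))
  refine ⟨σ, { toFun := Φ, map_add' := hΦadd, map_smul' := hΦsmul }, fun x => ?_⟩
  change g x ∈ Submodule.span K' {g 0 + Φ x}
  by_cases hx : x ∈ hg.pencil 0
  -- The point `x`, with the same image as `0`, is on the line through `x + z` and `x + k • z`,
  -- whose images lie in the span of `g 0 + Φ x` and `d z`. Two independent choices of `z` leave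
  -- only a nonzero multiple of `g 0`.
  · have hcomb : ∀ z, z ∉ hg.pencil 0 → ∃ α β : K', g 0 + Φ x = α • g 0 + β • d z ∧
        (β = 0 → α ≠ 0) := by
      intro z hz
      obtain ⟨k, hk0, hk1⟩ := exists_notMem_of_three_le hK3 0 1
      have hmem : ∀ k : K, k ≠ 0 → g (x + k • z) ∈ Submodule.span K' {g 0 + Φ x, d z} := by
        intro k hk
        have hkz : k • z ∉ hg.pencil 0 := fun h => hz (((hg.pencil 0).smul_mem_iff hk).1 h)
        have h1 := (hd (x + k • z) (fun h => hkz ((add_mem_cancel_left hx).1 h))).mem_one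
        rw [key x (k • z) (fun h => hkz (hg.pencil_mono hx h)), hsmul k z hk hz] at h1
        refine (Submodule.span_singleton_le_iff_mem _ _).2 ?_ h1
        exact Submodule.mem_span_pair.2 ⟨1, σ k, by rw [one_smul, add_assoc]⟩
      have h1 := hg.mem _ (x + z) ((k - 1) • z) 0 (by simpa using hmem 1 one_ne_zero)
        (by simpa [sub_smul] using hmem k hk0) (by simpa using hmem 1 one_ne_zero) (-(k - 1)⁻¹) 0
      rw [smul_smul, neg_mul, inv_mul_cancel₀ (sub_ne_zero.2 hk1), neg_one_smul,
        add_neg_cancel_right, smul_zero, add_zero] at h1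
      obtain ⟨m, hm⟩ := Submodule.mem_span_singleton.1 (hg.mem_pencil_zero.1 hx)
      have hm0 : m ≠ 0 := by rintro rfl; exact hg.ne_zero x (by rw [← hm, zero_smul])
      rw [← hm, Submodule.smul_mem_iff _ hm0] at h1
      obtain ⟨α, β, h2⟩ := Submodule.mem_span_pair.1 h1
      have hα : α ≠ 0 := by
        rintro rfl
        have := pair_unique (hg.ne_zero 0) (hd z hz).notMem (α := 0) (β := β) (α' := 1) (β' := 0)
          (by simpa using h2)
        exact zero_ne_one this.1
      refine ⟨α⁻¹, -(α⁻¹ * β), ?_, fun _ => inv_ne_zero hα⟩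
      rw [neg_smul, mul_smul, ← sub_eq_add_neg, ← smul_sub, eq_inv_smul_iff₀ hα]
      exact eq_sub_of_add_eq h2
    obtain ⟨z, hz⟩ := hout z₀
    obtain ⟨α, β, h1, h1'⟩ := hcomb z₀ hz₀
    obtain ⟨α', β', h2, -⟩ := hcomb z (fun h => hz (hg.pencil_zero_le z₀ h))
    obtain ⟨-, h3, -⟩ := (hplane z₀ z hz₀ hz).1.triple_unique (a := α) (b := β) (c := 0)
      (a' := α') (b' := 0) (c' := β') (by simpa using h1.symm.trans h2)
    have hα := h1' h3
    obtain ⟨m, hm⟩ := Submodule.mem_span_singleton.1 (hg.mem_pencil_zero.1 hx)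
    refine Submodule.mem_span_singleton.2 ⟨m * α⁻¹, ?_⟩
    rw [h1, h3, zero_smul, add_zero, smul_smul, inv_mul_cancel_right₀ hα, hm]
  · rw [hΦd x hx]
    exact (hd x hx).mem_one

-- Off `pencil 0` this is uniqueness of the direction on each line; a point of `pencil 0` is a
-- difference of two points off it.
omit hK in
theorem semilinear_unique (hK3 : 3 ≤ Cardinal.mk K) {σ σ' : K →+* K'} (Φ : U →ₛₗ[σ] V')
    (Ψ : U →ₛₗ[σ'] V') (hΦ : ∀ x, g x ∈ Submodule.span K' {g 0 + Φ x})
    (hΨ : ∀ x, g x ∈ Submodule.span K' {g 0 + Ψ x}) : σ = σ' ∧ ∀ x, Φ x = Ψ x := by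
  have haux : ∀ {ρ : K →+* K'} (Θ : U →ₛₗ[ρ] V'), (∀ x, g x ∈ Submodule.span K' {g 0 + Θ x}) →
      ∀ x, x ∉ hg.pencil 0 → IsSemiaffineAlong g ρ x (Θ x) := by
    intro ρ Θ hΘ x hx
    refine ⟨fun h => hx (hg.mem_pencil_zero.2 ?_), fun t => by simpa using hΘ (t • x)⟩
    exact (Submodule.span_singleton_le_iff_mem _ _).2
      (Submodule.add_mem _ (Submodule.mem_span_singleton_self _) h) (hΘ x)
  have key : ∀ x, x ∉ hg.pencil 0 → σ = σ' ∧ Φ x = Ψ x := fun x hx =>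
    hg.semiaffine_unique hK3 (haux Φ hΦ x hx) (haux Ψ hΨ x hx)
  obtain ⟨z, hz⟩ : ∃ z, z ∉ hg.pencil 0 := hspan _ _
  refine ⟨(key z hz).1, fun x => ?_⟩
  by_cases hx : x ∈ hg.pencil 0
  · have h := (key (x + z) (fun h => hz ((add_mem_cancel_left hx).1 h))).2
    rw [map_add, map_add, (key z hz).2] at h
    exact add_right_cancel h
  · exact (key x hx).2

end IsFlatLift

end Affine

/-! ### Passage between projective points and vectors -/

section Projective

variable {K V K' V' : Type*} [DivisionRing K] [AddCommGroup V] [Module K V]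
  [DivisionRing K'] [AddCommGroup V'] [Module K' V']

theorem mem_projectivization_iff_rep_mem (W : Submodule K V) (x : ℙ K V) :
    x ∈ W.projectivization ↔ x.rep ∈ W := by
  conv_lhs => rw [← x.mk_rep]
  exact Submodule.mk_mem_projectivization_iff W x.rep_nonzero

/-- An affino-projective set contains the complement of the kernel of a linear form. -/
theorem exists_linearForm_of_isAffinoProjective {X : Set (ℙ K V)}
    (hX : (projectiveGeometry K V).IsAffinoProjective X) :
    ∃ (l : V →ₗ[K] K) (v₀ : V), l v₀ = 1 ∧
      ∀ v (hv : v ≠ 0), l v ≠ 0 → Projectivization.mk K v hv ∈ X := by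
  obtain ⟨_, ⟨⟨S, rfl⟩, hne, hmax⟩, hXH⟩ := hX
  have hlt : S.submodule < ⊤ := by
    rw [lt_top_iff_ne_top]
    intro h
    refine hne (Set.eq_univ_of_forall fun x => ?_)
    have hx : x.rep ∈ S.submodule := h ▸ Submodule.mem_top
    rw [Projectivization.Subspace.mem_submodule_iff _ x.rep_nonzero, x.mk_rep] at hx
    exact hx
  obtain ⟨l, hl0, hl⟩ := Submodule.exists_le_ker_of_lt_top _ hlt
  obtain ⟨w, hw⟩ : ∃ w, l w ≠ 0 := by
    by_contra! h
    exact hl0 (LinearMap.ext h)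
  refine ⟨l, (l w)⁻¹ • w, by rw [map_smul, smul_eq_mul, inv_mul_cancel₀ hw], fun v hv hlv => ?_⟩
  rcases (hXH ▸ Set.mem_univ _ : Projectivization.mk K v hv ∈ X ∪ (S : Set (ℙ K V))) with h | h
  · exact h
  · exact absurd (hl ((Projectivization.Subspace.mem_submodule_iff S hv).2 h)) hlv

/-- This is the morphism property in terms of vectors; it also covers the points of `X` at infinity.
-/
theorem exists_submodule_rep_mem_iff {X : Set (ℙ K V)} {f : X → ℙ K' V'}
    (hf : ((projectiveGeometry K V).subgeometry X).IsMorphism (projectiveGeometry K' V') f)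
    (W : Submodule K' V') : ∃ M : Submodule K V, ∀ v (hv : v ≠ 0)
      (hx : Projectivization.mk K v hv ∈ X), (f ⟨_, hx⟩).rep ∈ W ↔ v ∈ M := by
  obtain ⟨_, ⟨S, rfl⟩, hS⟩ := hf (W.projectivization : Set (ℙ K' V')) ⟨_, rfl⟩
  refine ⟨S.submodule, fun v hv hx => ?_⟩
  rw [Projectivization.Subspace.mem_submodule_iff _ hv, ← mem_projectivization_iff_rep_mem]
  exact Set.ext_iff.1 hS ⟨_, hx⟩

theorem exists_rep_notMem_of_not_isCollinear {S : Set (ℙ K V)}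
    (hS : ¬ Projectivization.IsCollinear S) (a c : V) :
    ∃ x ∈ S, x.rep ∉ Submodule.span K {a, c} := by
  by_contra! h
  refine hS ⟨(Submodule.span K {a, c}).projectivization, ?_, ?_, fun x hx =>
    (mem_projectivization_iff_rep_mem _ _).2 (h x hx)⟩
  · rw [Projectivization.Subspace.submodule.apply_symm_apply]
    exact Module.Finite.span_of_finite _ (Set.toFinite _)
  · rw [Projectivization.Subspace.submodule.apply_symm_apply]
    classical
    have h3 := finrank_span_finset_le_card (R := K) ({a, c} : Finset V)
    have h4 := Finset.card_le_two (a := a) (b := c)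
    rw [Set.finrank, Finset.coe_pair] at h3
    omega

theorem mem_partialProjectivization_iff {σ : K →+* K'} (Φ : V →ₛₗ[σ] V') {v : V} (hv : v ≠ 0)
    (y : ℙ K' V') : y ∈ partialProjectivization Φ (Projectivization.mk K v hv) ↔
      y.rep ∈ Submodule.span K' {Φ v} := by
  rw [mem_partialProjectivization_mk, Submodule.mem_span_singleton]
  constructor
  · rintro ⟨h, rfl⟩
    obtain ⟨a, ha⟩ := Projectivization.exists_smul_eq_mk_rep K' (Φ v) h
    exact ⟨a, ha⟩
  · rintro ⟨a, ha⟩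
    have h : Φ v ≠ 0 := fun h => y.rep_nonzero (by rw [← ha, h, smul_zero])
    refine ⟨h, ?_⟩
    rw [← y.mk_rep, Projectivization.mk_eq_mk_iff']
    exact ⟨a, ha⟩

theorem partialProjectivization_eq_of_smul {σ τ : K →+* K'} (Φ : V →ₛₗ[σ] V') (Ψ : V →ₛₗ[τ] V')
    {c : K'} (hc : c ≠ 0) (h : ∀ v, Φ v = c • Ψ v) :
    partialProjectivization Φ = partialProjectivization Ψ := by
  refine PFun.ext fun x y => ?_
  induction x with
  | h v hv =>
    rw [mem_partialProjectivization_iff, mem_partialProjectivization_iff, h,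
      Submodule.span_singleton_smul_eq (IsUnit.mk0 c hc)]

/-- A multiple of a semilinear map is semilinear with respect to a conjugate ring morphism. -/
theorem exists_smul_semilinear {σ : K →+* K'} (Φ : V →ₛₗ[σ] V') {c : K'} (hc : c ≠ 0) :
    ∃ (τ : K →+* K') (Ψ : V →ₛₗ[τ] V'), ∀ v, Ψ v = c • Φ v :=
  ⟨{ toFun := fun s => c * σ s * c⁻¹
     map_one' := by simp [hc]
     map_zero' := by simp
     map_add' := fun s t => by simp [mul_add, add_mul]
     map_mul' := fun s t => by simp [mul_assoc, hc] },
   { toFun := fun v => c • Φ v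
     map_add' := fun v w => by simp
     map_smul' := fun s v => by simp [smul_smul, mul_assoc, hc] }, fun _ => rfl⟩

end Projective

/-! ### Extension to the projective space and uniqueness -/

theorem proposition5p2 {K V K' V' : Type*}
    [DivisionRing K] [AddCommGroup V] [Module K V]
    [DivisionRing K'] [AddCommGroup V'] [Module K' V']
    (hK : 4 ≤ Cardinal.mk K ∨ (Cardinal.mk K = 3 ∧ CharP K' 3))
    (X : Set (ℙ K V)) (hX : (projectiveGeometry K V).IsAffinoProjective X)
    (f : X → ℙ K' V')
    (hf : ((projectiveGeometry K V).subgeometry X).IsMorphism (projectiveGeometry K' V') f)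
    (hline : ¬ Projectivization.IsCollinear (Set.range f)) :
    ∃! φ : ℙ K V →. ℙ K' V', IsPartialProjectiveMorphism φ ∧ ∀ x : X, f x ∈ φ x := by
  have hK3 : 3 ≤ Cardinal.mk K := hK.elim (le_trans (by norm_num)) fun h => h.1.ge
  obtain ⟨l, v₀, hl, hlX⟩ := exists_linearForm_of_isAffinoProjective hX
  have hlu : ∀ u : LinearMap.ker l, l (v₀ + u) = 1 := fun u => by
    rw [map_add, hl, LinearMap.mem_ker.1 u.2, add_zero]
  have hne : ∀ u : LinearMap.ker l, v₀ + (u : V) ≠ 0 := fun u h => by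
    have := hlu u
    rw [h, map_zero] at this
    exact zero_ne_one this
  have hmem : ∀ u : LinearMap.ker l, Projectivization.mk K _ (hne u) ∈ X := fun u =>
    hlX _ _ (by rw [hlu]; exact one_ne_zero)
  have hdecomp : ∀ v : V, v - l v • v₀ ∈ LinearMap.ker l := fun v => by
    rw [LinearMap.mem_ker, map_sub, map_smul, hl, smul_eq_mul, mul_one, sub_self]
  set g : LinearMap.ker l → V' := fun u => (f ⟨_, hmem u⟩).rep
  have hg : IsFlatLift K K' g := by
    refine ⟨fun x => Projectivization.rep_nonzero _, fun W p x y hp hx hy a b => ?_⟩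
    obtain ⟨M, hM⟩ := exists_submodule_rep_mem_iff hf W
    have hM' : ∀ u, g u ∈ W ↔ v₀ + (u : V) ∈ M := fun u => hM _ _ (hmem u)
    rw [hM'] at hp hx hy ⊢
    have hx' : (x : V) ∈ M := by
      have := M.sub_mem hx hp
      simpa [← add_assoc] using this
    have hy' : (y : V) ∈ M := by
      have := M.sub_mem hy hp
      simpa [← add_assoc] using this
    simpa [add_assoc] using M.add_mem hp (M.add_mem (M.smul_mem a hx') (M.smul_mem b hy'))
  have hspan : ∀ a c : V', ∃ x, g x ∉ Submodule.span K' {a, c} := by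
    intro a c
    by_contra! h
    obtain ⟨_, ⟨⟨x, hx⟩, rfl⟩, hxW⟩ := exists_rep_notMem_of_not_isCollinear hline a c
    obtain ⟨M, hM⟩ := exists_submodule_rep_mem_iff hf (Submodule.span K' {a, c})
    -- A submodule containing `v₀ + ker l` is all of `V`, so collinearity of the affine part would
    -- spread to `X`.
    have hM' : ∀ u : LinearMap.ker l, v₀ + (u : V) ∈ M := fun u => (hM _ _ (hmem u)).1 (h u)
    have h0 : v₀ ∈ M := by simpa using hM' 0
    induction x with
    | h v hv =>
      refine hxW ((hM v hv hx).2 ?_)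
      have := (M.add_mem_iff_right h0).1 (hM' ⟨_, hdecomp v⟩)
      simpa using M.add_mem this (M.smul_mem (l v) h0)
  obtain ⟨σ, Φ₀, hΦ₀⟩ := hg.exists_semilinear hK hspan
  let Φ : V →ₛₗ[σ] V' :=
    { toFun := fun v => σ (l v) • g 0 + Φ₀ ⟨_, hdecomp v⟩
      map_add' := fun v w => by
        have : (⟨_, hdecomp (v + w)⟩ : LinearMap.ker l) = ⟨_, hdecomp v⟩ + ⟨_, hdecomp w⟩ := by
          ext
          simp only [map_add, add_smul, Submodule.coe_add]
          abel
        rw [this, map_add, map_add, map_add, add_smul]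
        abel
      map_smul' := fun s v => by
        have : (⟨_, hdecomp (s • v)⟩ : LinearMap.ker l) = s • ⟨_, hdecomp v⟩ := by
          ext
          simp [smul_sub, mul_smul]
        rw [this, LinearMap.map_smulₛₗ Φ₀, LinearMap.map_smul l, smul_eq_mul, map_mul, mul_smul,
          smul_add] }
  have hΦdef : ∀ v, Φ v = σ (l v) • g 0 + Φ₀ ⟨_, hdecomp v⟩ := fun v => rfl
  have hΦu : ∀ u : LinearMap.ker l, Φ u = Φ₀ u := fun u => by
    have hu : l u = 0 := u.2
    simp [hΦdef, hu]
  have hΦv₀ : Φ v₀ = g 0 := by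
    have : (⟨_, hdecomp v₀⟩ : LinearMap.ker l) = 0 := by
      ext
      simp [hl]
    rw [hΦdef, this, map_zero, hl, map_one, one_smul, add_zero]
  have hΦmem : ∀ v (hv : v ≠ 0) (hx : Projectivization.mk K v hv ∈ X),
      (f ⟨_, hx⟩).rep ∈ Submodule.span K' {Φ v} := by
    intro v hv hx
    obtain ⟨M, hM⟩ := exists_submodule_rep_mem_iff hf (Submodule.span K' {Φ v})
    rw [hM v hv hx]
    by_cases hlv : l v = 0
    · lift v to LinearMap.ker l using hlv
      -- For `v` at infinity, the affine points `v₀ + p` and `v₀ + p + v` force the image of `v`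
      -- into the span of `Φ (v₀ + p)` and `Φ v`. This choice of `p` excludes a nonzero coefficient
      -- on `Φ (v₀ + p)`.
      obtain ⟨p, hp⟩ := hspan (f ⟨_, hx⟩).rep (Φ v)
      obtain ⟨N, hN⟩ := exists_submodule_rep_mem_iff hf (Submodule.span K' {Φ (v₀ + p), Φ v})
      have hN' : ∀ u : LinearMap.ker l, Φ (v₀ + u) ∈ Submodule.span K' {Φ (v₀ + p), Φ v} →
          v₀ + (u : V) ∈ N := by
        intro u hu
        rw [← hN _ _ (hmem u)]
        refine (Submodule.span_singleton_le_iff_mem _ _).2 hu ?_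
        rw [map_add, hΦv₀, hΦu]
        exact hΦ₀ u
      have h1 := hN' p (Submodule.subset_span (by simp))
      have h2 := hN' (p + v) (by
        rw [Submodule.coe_add, ← add_assoc, map_add Φ (v₀ + p)]
        exact Submodule.add_mem _ (Submodule.subset_span (by simp))
          (Submodule.subset_span (by simp)))
      rw [Submodule.coe_add, ← add_assoc, N.add_mem_iff_right h1, ← hN _ hv hx] at h2
      obtain ⟨α, β, hαβ⟩ := Submodule.mem_span_pair.1 h2
      rw [← hM v hv hx]
      have hα : α = 0 := by
        by_contra hα
        refine hp ((Submodule.span_singleton_le_iff_mem _ _).2 ?_ (hΦ₀ p))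
        rw [← hΦv₀, ← hΦu, ← map_add, ← Submodule.smul_mem_iff _ hα, eq_sub_of_add_eq hαβ]
        exact Submodule.sub_mem _ (Submodule.subset_span (by simp))
          (Submodule.smul_mem _ _ (Submodule.subset_span (by simp)))
      rw [hα, zero_smul, zero_add] at hαβ
      exact Submodule.mem_span_singleton.2 ⟨β, hαβ⟩
    · set u : LinearMap.ker l := (l v)⁻¹ • ⟨_, hdecomp v⟩ with hu
      have huv : (l v)⁻¹ • v = v₀ + u := by
        rw [hu, Submodule.coe_smul, smul_sub, inv_smul_smul₀ hlv, add_sub_cancel]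
      rw [← M.smul_mem_iff (inv_ne_zero hlv), huv, ← hM _ _ (hmem u)]
      refine (Submodule.span_singleton_le_iff_mem _ _).2 ?_ (hΦ₀ u)
      rw [← hΦv₀, ← hΦu, ← map_add, ← huv, LinearMap.map_smulₛₗ]
      exact Submodule.smul_mem _ _ (Submodule.mem_span_singleton_self _)
  refine ⟨partialProjectivization Φ, ⟨⟨σ, Φ, rfl⟩, ?_⟩, ?_⟩
  · rintro ⟨x, hx⟩
    induction x with
    | h v hv => exact (mem_partialProjectivization_iff Φ hv _).2 (hΦmem v hv hx)
  · rintro _ ⟨⟨τ, Ψ, rfl⟩, hΨ⟩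
    have hΨu : ∀ u : LinearMap.ker l, g u ∈ Submodule.span K' {Ψ (v₀ + u)} := fun u =>
      (mem_partialProjectivization_iff Ψ (hne u) _).1 (hΨ ⟨_, hmem u⟩)
    -- The scalar `c` normalizes `Ψ` to take the value `g 0` at `v₀`, as `Φ` does.
    obtain ⟨c, hc⟩ := Submodule.mem_span_singleton.1 (hΨu 0)
    have hc0 : c ≠ 0 := by rintro rfl; exact hg.ne_zero 0 (by rw [← hc, zero_smul])
    rw [ZeroMemClass.coe_zero, add_zero] at hc
    obtain ⟨τ', Ψ', hΨ'⟩ := exists_smul_semilinear Ψ hc0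
    have hΨ'u : ∀ u : LinearMap.ker l,
        g u ∈ Submodule.span K' {g 0 + (Ψ'.comp (LinearMap.ker l).subtype) u} := by
      intro u
      rw [LinearMap.comp_apply, Submodule.subtype_apply, hΨ', ← hc, ← smul_add, ← map_add,
        Submodule.span_singleton_smul_eq (IsUnit.mk0 c hc0)]
      exact hΨu u
    obtain ⟨rfl, hΦΨ⟩ := hg.semilinear_unique hspan hK3 Φ₀ _ hΦ₀ hΨ'u
    refine (partialProjectivization_eq_of_smul Φ Ψ hc0 fun v => ?_).symm
    rw [← hΨ', hΦdef, hΦΨ, LinearMap.comp_apply, Submodule.subtype_apply, map_sub,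
      LinearMap.map_smulₛₗ, hΨ' v₀, hc, add_sub_cancel]
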